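/- Let $q$ be an odd prime power and let $\sigma$ be a permutation of the finite field $\mathbb{F}_q$. A collinear triple of $\sigma$ is a set of three distinct points of the graph $\Gamma=\{(x,\sigma(x)) : x\in\mathbb{F}_q\}$ that lie on a common line of the affine plane $\mathbb{F}_q^2$. Let $\Omega=\{[x:\sigma(x):1] : x\in\mathbb{F}_q\}\cup\{[1:0:0],[0:1:0]\}\subset PG(2,q)$, and let $k^*(\Omega)$ be the number of lines of $PG(2,q)$ that meet $\Omega$. Then $\sigma$ minimizes the number of collinear triples among all permutations of $\mathbb{F}_q$ if and only if it has exactly $(q-1)/2$ collinear triples; and if $\sigma$ is such a minimizing permutation, then $$k^*(\Omega)=\frac{(q+1)(q+2)}{2}+\frac{q-1}{2}.$$ -/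

import Mathlib

namespace CollinearTriples

open scoped LinearAlgebra.Projectivization

/-- The graph `{(x, σ x) : x ∈ F}` of a permutation of `F`, a set of points of the affine plane. -/
def permGraph {F : Type*} (σ : Equiv.Perm F) : Set (F × F) :=
  {p | p.2 = σ p.1}

/-- The collinear triples of a permutation: the sets of three distinct points of its graph that
lie on a common line of the affine plane `F × F`. -/
def collinearTriples {F : Type*} [Field F] (σ : Equiv.Perm F) : Set (Finset (F × F)) :=
  {T | (T : Set (F × F)) ⊆ permGraph σ ∧ T.card = 3 ∧ Collinear F (T : Set (F × F))}

/-- The number of collinear triples of a permutation. -/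
noncomputable def numCollinearTriples {F : Type*} [Field F] (σ : Equiv.Perm F) : ℕ :=
  (collinearTriples σ).ncard

/-- `σ` minimizes the number of collinear triples among all permutations of `F`. -/
def IsMinimizing {F : Type*} [Field F] (σ : Equiv.Perm F) : Prop :=
  ∀ τ : Equiv.Perm F, numCollinearTriples σ ≤ numCollinearTriples τ

/-- The projective plane over `F`: nonzero vectors of `F ^ 3` up to nonzero scalars. -/
abbrev ProjPlane (F : Type*) [Field F] : Type _ := ℙ F (Fin 3 → F)

/-- A set of points of the projective plane is a line if it consists of the points that lie in
some two-dimensional linear subspace of `F ^ 3`. -/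
def IsLine {F : Type*} [Field F] (l : Set (ProjPlane F)) : Prop :=
  ∃ W : Submodule F (Fin 3 → F), Module.finrank F W = 2 ∧ l = {P | P.submodule ≤ W}

/-- The number of lines of the projective plane that meet the point set `S`. -/
noncomputable def numLinesMeeting {F : Type*} [Field F] (S : Set (ProjPlane F)) : ℕ :=
  {l : Set (ProjPlane F) | IsLine l ∧ (l ∩ S).Nonempty}.ncard

theorem affine_ne_zero {F : Type*} [Field F] (x y : F) : (![x, y, 1] : Fin 3 → F) ≠ 0 :=
  fun h => one_ne_zero (congrFun h 2)

theorem e₀_ne_zero {F : Type*} [Field F] : (![1, 0, 0] : Fin 3 → F) ≠ 0 :=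
  fun h => one_ne_zero (congrFun h 0)

theorem e₁_ne_zero {F : Type*} [Field F] : (![0, 1, 0] : Fin 3 → F) ≠ 0 :=
  fun h => one_ne_zero (congrFun h 1)

/-- The embedding `(x, y) ↦ [x : y : 1]` of the affine plane into the projective plane. -/
def rho {F : Type*} [Field F] (p : F × F) : ProjPlane F :=
  Projectivization.mk F ![p.1, p.2, 1] (affine_ne_zero p.1 p.2)

/-- The set `Ω`: the image of the graph of `σ` in the projective plane, together with the two
points `[1 : 0 : 0]` and `[0 : 1 : 0]`. -/
def Omega {F : Type*} [Field F] (σ : Equiv.Perm F) : Set (ProjPlane F) :=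
  rho '' permGraph σ ∪
    {Projectivization.mk F ![1, 0, 0] e₀_ne_zero, Projectivization.mk F ![0, 1, 0] e₁_ne_zero}

end CollinearTriples

namespace CollinearTriples

/-! Let n be the number of graph points on an oblique line y = m x + b, m ≠ 0. No other affine line
holds two graph points, so there are Σ C(n, 3) collinear triples, and Σ n = Σ n(n-1) = q(q-1).

For the lower bound, take (m, b) as a point of the dual plane. Every dual line missing the origin is
a parallel class of nonzero slope or a pencil of lines through a point; parity, or Wilson's theorem
when that point is on the graph, puts an oblique line with n odd in it. By the polynomial method
(`two_mul_card_sub_one_le_card_of_blocking`) at least 2(q-1) oblique lines have n odd, and the two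
sums turn this into Σ C(n-1, 2) ≥ (q-1)/2. As C(n-1, 2) ≤ C(n, 3), the same bound holds for triples,
and x ↦ x⁻¹ attains it.

A minimizer thus has Σ C(n-1, 2) = (q-1)/2, which determines how many oblique lines meet the graph.
The other 2q+1 projective lines all meet Ω at infinity. -/

open Finset

section Secant

variable {F : Type*} [Field F]

/-- The line through the points of the graph of `σ` over `x` and `x'`. -/
def secant (σ : Equiv.Perm F) (x x' : F) : F × F :=
  ((σ x' - σ x) / (x' - x), σ x - (σ x' - σ x) / (x' - x) * x)

theorem secant_eq_iff (σ : Equiv.Perm F) {x x' : F} (h : x ≠ x') (l : F × F) :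
    secant σ x x' = l ↔ σ x = l.1 * x + l.2 ∧ σ x' = l.1 * x' + l.2 := by
  have h' : x' - x ≠ 0 := sub_ne_zero.2 h.symm
  obtain ⟨m, b⟩ := l
  simp only [secant, Prod.mk.injEq]
  constructor
  · rintro ⟨rfl, rfl⟩
    constructor
    · ring
    · field_simp
      ring
  · rintro ⟨h1, h2⟩
    have : (σ x' - σ x) / (x' - x) = m := by
      rw [h1, h2]
      field_simp
      ring
    refine ⟨this, ?_⟩
    rw [this, h1]
    ring

theorem secant_fst_ne_zero (σ : Equiv.Perm F) {x x' : F} (h : x ≠ x') :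
    (secant σ x x').1 ≠ 0 :=
  div_ne_zero (sub_ne_zero.2 (σ.injective.ne h.symm)) (sub_ne_zero.2 h.symm)

end Secant

/-! ### Blocking the lines that miss the origin -/

/-- A finite set of points `(m, b)` that meets every line `α * m + β * b = 1` has at least
`2 * (q - 1)` elements. -/
theorem two_mul_card_sub_one_le_card_of_blocking {F : Type*} [Field F] [Fintype F] (S : Finset (F × F))
    (hS : ∀ α β : F, (α, β) ≠ 0 → ∃ l ∈ S, α * l.1 + β * l.2 = 1) :
    2 * (Fintype.card F - 1) ≤ #S := by
  by_contra! hlt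
  let f : MvPolynomial (Fin 2) F := ∏ l ∈ S,
    (1 - (MvPolynomial.C l.1 * MvPolynomial.X 0 + MvPolynomial.C l.2 * MvPolynomial.X 1))
  have hdeg : f.totalDegree ≤ #S := by
    refine (MvPolynomial.totalDegree_finsetProd _ _).trans ?_
    rw [card_eq_sum_ones]
    refine sum_le_sum fun l _ => ?_
    refine (MvPolynomial.totalDegree_sub _ _).trans (max_le (by simp) ?_)
    refine (MvPolynomial.totalDegree_add _ _).trans (max_le ?_ ?_) <;>
    · refine (MvPolynomial.totalDegree_mul _ _).trans ?_
      simp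
  have heval : ∀ u, MvPolynomial.eval u f = ∏ l ∈ S, (1 - (l.1 * u 0 + l.2 * u 1)) := by
    intro u
    simp [f, map_prod]
  -- A polynomial in two variables of degree below 2(q-1) sums to zero over the plane. Yet `f` is 1
  -- at the origin and, by the blocking property, 0 elsewhere.
  have hsum := MvPolynomial.sum_eval_eq_zero f (by
    simp only [Fintype.card_fin]
    rw [mul_comm]
    omega)
  rw [Fintype.sum_eq_single 0] at hsum
  · rw [heval] at hsum
    simp at hsum
  · intro u hu
    rw [heval]
    obtain ⟨l, hl, h1⟩ := hS (u 0) (u 1) (by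
      contrapose! hu
      rw [Prod.mk_eq_zero] at hu
      ext i
      fin_cases i
      · exact hu.1
      · exact hu.2)
    refine prod_eq_zero hl ?_
    rw [← h1]
    ring

/-! ### Incidences of the graph with oblique lines -/

section Counting

variable {F : Type*} [Field F] [Fintype F] [DecidableEq F]

/-- The number of points of the graph of `σ` on the line `y = m * x + b`, where `l = (m, b)`. -/
def lineCount (σ : Equiv.Perm F) (l : F × F) : ℕ :=
  #{x | σ x = l.1 * x + l.2}

/-- The pairs `(m, b)` with `m ≠ 0`, which stand for the lines `y = m * x + b` that are neither
horizontal nor vertical. -/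
def obliqueLines (F : Type*) [Field F] [Fintype F] [DecidableEq F] : Finset (F × F) :=
  {l | l.1 ≠ 0}

theorem mem_obliqueLines {l : F × F} : l ∈ obliqueLines F ↔ l.1 ≠ 0 := by
  simp [obliqueLines]

theorem sum_lineCount_of_slope (σ : Equiv.Perm F) (m : F) :
    ∑ b, lineCount σ (m, b) = Fintype.card F := by
  rw [← card_univ, card_eq_sum_card_fiberwise (f := fun x => σ x - m * x) (t := univ)
    (fun _ _ => by simp)]
  refine sum_congr rfl fun b _ => ?_
  unfold lineCount
  congr 1
  ext x
  simp [sub_eq_iff_eq_add, add_comm]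

theorem obliqueLines_eq_product : obliqueLines F = univ.erase 0 ×ˢ univ := by
  ext l
  simp [obliqueLines]

theorem sum_lineCount (σ : Equiv.Perm F) :
    ∑ l ∈ obliqueLines F, lineCount σ l = (Fintype.card F - 1) * Fintype.card F := by
  rw [obliqueLines_eq_product, sum_product]
  simp [sum_lineCount_of_slope, card_erase_of_mem]

/-- Both sides count ordered pairs of distinct graph points: each pair spans one line, oblique
because σ is injective. -/
theorem sum_lineCount_mul_sub_one (σ : Equiv.Perm F) :
    ∑ l ∈ obliqueLines F, lineCount σ l * (lineCount σ l - 1) =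
      (Fintype.card F - 1) * Fintype.card F := by
  have h := card_eq_sum_card_fiberwise (s := (univ : Finset F).offDiag)
    (f := fun p => secant σ p.1 p.2) (t := obliqueLines F) (fun p hp => by
      have : p.1 ≠ p.2 := by simpa using hp
      simpa [obliqueLines] using secant_fst_ne_zero σ this)
  rw [offDiag_card, card_univ, ← Nat.sub_one_mul] at h
  rw [h]
  refine sum_congr rfl fun l _ => ?_
  rw [Nat.mul_sub_one, lineCount, ← offDiag_card]
  congr 1
  ext p
  simp only [mem_offDiag, mem_filter, mem_univ, true_and]
  constructor
  · rintro ⟨h1, h2, h3⟩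
    exact ⟨h3, (secant_eq_iff σ h3 l).2 ⟨h1, h2⟩⟩
  · rintro ⟨h3, h4⟩
    have := (secant_eq_iff σ h3 l).1 h4
    exact ⟨this.1, this.2, h3⟩

/-- Every nonzero slope is the slope of a line with an odd number of points of the graph. -/
theorem exists_odd_lineCount_of_slope (hq : Odd (Fintype.card F)) (σ : Equiv.Perm F) (m : F) :
    ∃ b, Odd (lineCount σ (m, b)) := by
  by_contra! h
  simp only [Nat.not_odd_iff_even] at h
  have := even_sum (s := univ) _ fun b _ => h b
  rw [sum_lineCount_of_slope] at this
  exact Nat.not_even_iff_odd.2 hq this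

theorem lineCount_through (σ : Equiv.Perm F) (x y m : F) :
    lineCount σ (m, y - m * x) = #{x' | σ x' - y = m * (x' - x)} := by
  unfold lineCount
  congr 1
  ext x'
  simp only [mem_filter, mem_univ, true_and]
  constructor <;> intro h <;> linear_combination h

theorem prod_erase_zero_eq_neg_one : ∏ m ∈ (univ : Finset F).erase 0, m = -1 := by
  have h := congrArg (Units.val (α := F)) (FiniteField.prod_univ_units_id_eq_neg_one (K := F))
  rw [Units.coe_prod, Units.val_neg, Units.val_one] at h
  rw [← h]
  refine (prod_nbij (fun u : Fˣ => (u : F)) (by simp) (fun u _ v _ huv => Units.ext huv) ?_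
    (fun _ _ => rfl)).symm
  intro m hm
  have hm0 : m ≠ 0 := by simpa using hm
  exact ⟨Units.mk0 m hm0, by simp, rfl⟩

theorem prod_perm_sub_eq_neg_one (σ : Equiv.Perm F) (x : F) :
    ∏ x' ∈ univ.erase x, (σ x' - σ x) = -1 := by
  rw [← prod_erase_zero_eq_neg_one (F := F)]
  refine prod_nbij (fun x' => σ x' - σ x) ?_ ?_ ?_ (fun _ _ => rfl)
  · intro x' hx'
    simpa [sub_eq_zero] using hx'
  · intro a _ b _ hab
    simpa using hab
  · intro m hm
    refine ⟨σ.symm (m + σ x), ?_, by simp⟩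
    simpa [Equiv.symm_apply_eq] using hm

/-- Every point lies on an oblique line that has an odd number of points of the graph. -/
theorem exists_odd_lineCount_of_point (hq : Odd (Fintype.card F)) (σ : Equiv.Perm F) (x y : F) :
    ∃ m, m ≠ 0 ∧ Odd (lineCount σ (m, y - m * x)) := by
  by_contra! h
  simp only [Nat.not_odd_iff_even, lineCount_through] at h
  by_cases hy : σ x = y
  · subst hy
    -- For a point on the graph, an even count is at least 2, so each of the q-1 nonzero slopes is
    -- taken by one of the q-1 other graph points, hence by exactly one. The product of the slopes
    -- is then -1 by Wilson, but also (-1)/(-1) = 1.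
    have hsurj : Set.SurjOn (fun x' => (σ x' - σ x) / (x' - x))
        ((univ : Finset F).erase x) ((univ : Finset F).erase 0) := by
      intro m hm
      have hm0 : m ≠ 0 := by simpa using hm
      have hpos : 0 < #{x' | σ x' - σ x = m * (x' - x)} := card_pos.2 ⟨x, by simp⟩
      obtain ⟨k, hk⟩ := h m hm0
      obtain ⟨x', hx', hne⟩ := exists_mem_ne (by omega : 1 < #{x' | σ x' - σ x = m * (x' - x)}) x
      refine ⟨x', by simpa using hne, ?_⟩
      rw [mem_filter_univ] at hx'
      simp [hx', sub_ne_zero.2 hne]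
    have hcard : #((univ : Finset F).erase x) ≤ #((univ : Finset F).erase 0) := by
      simp [card_erase_of_mem]
    have hmaps : Set.MapsTo (fun x' => (σ x' - σ x) / (x' - x))
        ((univ : Finset F).erase x) ((univ : Finset F).erase 0) := by
      intro x' hx'
      have hne : x' ≠ x := by simpa using hx'
      simp [sub_eq_zero, hne]
    have hprod := prod_nbij (fun x' => (σ x' - σ x) / (x' - x)) hmaps
      (injOn_of_surjOn_of_card_le _ hmaps hsurj hcard) hsurj
      (f := fun x' => (σ x' - σ x) / (x' - x)) (g := id) (fun _ _ => rfl)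
    have hid := prod_perm_sub_eq_neg_one (Equiv.refl F) x
    simp only [Equiv.refl_apply] at hid
    simp only [prod_div_distrib, id, prod_perm_sub_eq_neg_one, hid,
      prod_erase_zero_eq_neg_one] at hprod
    rw [div_self (by simp)] at hprod
    have hchar : ringChar F ≠ 2 := fun h2 =>
      Nat.not_even_iff_odd.2 hq (Nat.even_iff.2 (FiniteField.even_card_iff_char_two.1 h2))
    exact Ring.neg_one_ne_one_of_char_ne_two hchar hprod.symm
  -- Off the graph, the vertical and the horizontal line through the point hold one graph point
  -- each; the q-2 others, an odd number, lie on the oblique lines.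
  · have hsum : ∑ m, #{x' | σ x' - y = m * (x' - x)} = Fintype.card F - 1 := by
      rw [← card_univ, ← card_erase_of_mem (mem_univ x),
        card_eq_sum_card_fiberwise (f := fun x' => (σ x' - y) / (x' - x)) (t := univ)
        (fun _ _ => by simp)]
      refine sum_congr rfl fun m _ => ?_
      congr 1
      ext x'
      simp only [mem_filter, mem_univ, true_and, mem_erase, and_true]
      by_cases hx : x' = x
      · simp [hx, sub_eq_zero, hy]
      · simp [hx, div_eq_iff (sub_ne_zero.2 hx)]
    rw [← add_sum_erase univ _ (mem_univ 0)] at hsum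
    have hzero : #{x' | σ x' - y = 0 * (x' - x)} = 1 := by
      rw [card_eq_one]
      refine ⟨σ.symm y, ?_⟩
      ext x'
      simp [sub_eq_zero, Equiv.eq_symm_apply]
    rw [hzero] at hsum
    have heven := even_sum (s := univ.erase (0 : F)) (fun m => #{x' | σ x' - y = m * (x' - x)})
      fun m hm => h m (by simpa using hm)
    obtain ⟨k, hk⟩ := heven
    obtain ⟨r, hr⟩ := hq
    omega

theorem two_mul_card_sub_one_le_card_odd (hq : Odd (Fintype.card F)) (σ : Equiv.Perm F) :
    2 * (Fintype.card F - 1) ≤ #{l ∈ obliqueLines F | Odd (lineCount σ l)} := by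
  refine two_mul_card_sub_one_le_card_of_blocking _ fun α β h => ?_
  by_cases hβ : β = 0
  · have hα : α ≠ 0 := fun hα => h (by rw [hα, hβ]; rfl)
    obtain ⟨b, hb⟩ := exists_odd_lineCount_of_slope hq σ α⁻¹
    exact ⟨(α⁻¹, b), by simp [mem_obliqueLines, hα, hb], by simp [hα, hβ]⟩
  -- Dividing α m + β b = 1 by β says that y = m x + b passes through (α/β, 1/β).
  · obtain ⟨m, hm, hodd⟩ := exists_odd_lineCount_of_point hq σ (α / β) (1 / β)
    refine ⟨_, mem_filter.2 ⟨mem_obliqueLines.2 hm, hodd⟩, ?_⟩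
    field_simp
    ring

/-- The excess `∑ (n - 1).choose 2` of the line counts `n` is at least half of `q - 1`. -/
theorem card_sub_one_le_two_mul_sum_choose_two (hq : Odd (Fintype.card F)) (σ : Equiv.Perm F) :
    Fintype.card F - 1 ≤ 2 * ∑ l ∈ obliqueLines F, (lineCount σ l - 1).choose 2 := by
  -- Equality holds for n ≤ 3; at n = 0 truncated subtraction makes the binomial vanish.
  have hpoint : ∀ n : ℕ, (if Odd n then 1 else 0) + n * (n - 1) ≤ 4 * (n - 1).choose 2 + n := by
    rintro (_ | _ | _ | n)
    · simp
    · simp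
    · simp
    · have h1 : n + 1 + 1 + 1 - 1 = n + 2 := by omega
      have h2 : 2 * (n + 2).choose 2 = (n + 2) * (n + 1) := by
        rw [Nat.choose_two_right, Nat.mul_div_cancel' (Nat.even_mul_pred_self _).two_dvd]
        rfl
      rw [h1]
      split_ifs with hodd
      · nlinarith
      · rcases n with _ | n
        · exact absurd (by decide) hodd
        · nlinarith
  have h := sum_le_sum fun l (_ : l ∈ obliqueLines F) => hpoint (lineCount σ l)
  rw [sum_add_distrib, sum_add_distrib, sum_lineCount_mul_sub_one, sum_lineCount, ← mul_sum,
    ← card_filter] at h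
  have := two_mul_card_sub_one_le_card_odd hq σ
  omega

theorem choose_pred_two_le_choose_three (n : ℕ) : (n - 1).choose 2 ≤ n.choose 3 := by
  rcases n with _ | n
  · simp
  · rw [Nat.choose_succ_succ' n 2]
    exact Nat.le_add_right _ _

/-! ### Collinear triples as a sum over oblique lines -/

/-- The embedding of `F` into the plane as the graph of `σ`. -/
def graphEmbedding {F : Type*} (σ : Equiv.Perm F) : F ↪ F × F :=
  ⟨fun x => (x, σ x), fun _ _ h => congrArg Prod.fst h⟩

@[simp]
theorem graphEmbedding_apply {F : Type*} (σ : Equiv.Perm F) (x : F) :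
    graphEmbedding σ x = (x, σ x) :=
  rfl

theorem collinearTriples_eq_image (σ : Equiv.Perm F) :
    collinearTriples σ = (fun U : Finset F => U.map (graphEmbedding σ)) ''
      ↑((obliqueLines F).biUnion fun l => powersetCard 3 {x | σ x = l.1 * x + l.2}) := by
  ext T
  simp only [collinearTriples, Set.mem_ofPred_eq, Set.mem_image, mem_coe, mem_biUnion,
    mem_powersetCard, mem_obliqueLines]
  constructor
  · rintro ⟨hT, hcard, hcol⟩
    have hmap : (T.image Prod.fst).map (graphEmbedding σ) = T := by
      ext p
      simp only [mem_map, mem_image, graphEmbedding_apply]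
      constructor
      · rintro ⟨_, ⟨p', hp', rfl⟩, rfl⟩
        have : p'.2 = σ p'.1 := hT hp'
        rwa [← this]
      · intro hp
        have : p.2 = σ p.1 := hT hp
        exact ⟨p.1, ⟨p, hp, rfl⟩, by rw [← this]⟩
    obtain ⟨p, hp, p', hp', hne⟩ := one_lt_card.1 (by omega : 1 < #T)
    have hgp : p.2 = σ p.1 := hT hp
    have hgp' : p'.2 = σ p'.1 := hT hp'
    have hx : p.1 ≠ p'.1 := fun h => hne (Prod.ext h (by rw [hgp, hgp', h]))
    refine ⟨T.image Prod.fst, ⟨secant σ p.1 p'.1, secant_fst_ne_zero σ hx, ?_, ?_⟩, hmap⟩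
    · intro x hxT
      obtain ⟨s, hs, rfl⟩ := mem_image.1 hxT
      obtain ⟨v, hv⟩ := (collinear_iff_of_mem (mem_coe.2 hp)).1 hcol
      obtain ⟨r, hr⟩ := hv p' (mem_coe.2 hp')
      obtain ⟨t, ht⟩ := hv s (mem_coe.2 hs)
      have hgs : s.2 = σ s.1 := hT hs
      have e1 : p'.1 = r * v.1 + p.1 := by rw [hr]; simp
      have e2 : p'.2 = r * v.2 + p.2 := by rw [hr]; simp
      have e3 : s.1 = t * v.1 + p.1 := by rw [ht]; simp
      have e4 : s.2 = t * v.2 + p.2 := by rw [ht]; simp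
      have hd : p'.1 - p.1 ≠ 0 := sub_ne_zero.2 hx.symm
      rw [mem_filter_univ]
      simp only [secant]
      rw [← hgp, ← hgp', ← hgs]
      field_simp
      rw [e1, e2, e3, e4]
      ring
    · rw [← hmap, card_map] at hcard
      exact hcard
  · rintro ⟨U, ⟨l, -, hU, hcard⟩, rfl⟩
    refine ⟨?_, by rw [card_map, hcard], ?_⟩
    · intro p hp
      obtain ⟨x, -, rfl⟩ := mem_map.1 (mem_coe.1 hp)
      rfl
    · obtain ⟨x₀, hx₀⟩ : U.Nonempty := card_pos.1 (by omega)
      refine (collinear_iff_of_mem (mem_coe.2 (mem_map_of_mem _ hx₀))).2 ⟨(1, l.1), ?_⟩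
      intro p hp
      obtain ⟨x, hx, rfl⟩ := mem_map.1 (mem_coe.1 hp)
      have h0 := hU hx₀
      have h1 := hU hx
      rw [mem_filter_univ] at h0 h1
      refine ⟨x - x₀, Prod.ext ?_ ?_⟩
      · simp
      · simp [h0, h1]
        ring

theorem numCollinearTriples_eq_sum (σ : Equiv.Perm F) :
    numCollinearTriples σ = ∑ l ∈ obliqueLines F, (lineCount σ l).choose 3 := by
  rw [numCollinearTriples, collinearTriples_eq_image,
    Set.ncard_image_of_injective _ (map_injective _), Set.ncard_coe_finset, card_biUnion]
  · simp only [card_powersetCard, lineCount]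
  · intro l _ l' _ hne
    rw [Function.onFun, disjoint_left]
    intro U hU hU'
    rw [mem_powersetCard] at hU hU'
    obtain ⟨x, hx, x', hx', hxx⟩ := one_lt_card.1 (by omega : 1 < #U)
    have h1 := hU.1 hx
    have h2 := hU.1 hx'
    have h3 := hU'.1 hx
    have h4 := hU'.1 hx'
    rw [mem_filter_univ] at h1 h2 h3 h4
    exact hne (((secant_eq_iff σ hxx l).2 ⟨h1, h2⟩).symm.trans
      ((secant_eq_iff σ hxx l').2 ⟨h3, h4⟩))

theorem card_sub_one_le_two_mul_numCollinearTriples (hq : Odd (Fintype.card F))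
    (σ : Equiv.Perm F) : Fintype.card F - 1 ≤ 2 * numCollinearTriples σ := by
  rw [numCollinearTriples_eq_sum]
  exact (card_sub_one_le_two_mul_sum_choose_two hq σ).trans (Nat.mul_le_mul_left 2
    (sum_le_sum fun _ _ => choose_pred_two_le_choose_three _))

/-! ### Inversion attains the bound -/

/-- The permutation `x ↦ x⁻¹`, with `0 ↦ 0`. -/
def invPerm (F : Type*) [Field F] : Equiv.Perm F :=
  Function.Involutive.toPerm (fun x => x⁻¹) inv_inv

theorem card_filter_quadratic_le_two {m : F} (hm : m ≠ 0) (b : F) :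
    #{x | x ≠ 0 ∧ x⁻¹ = m * x + b} ≤ 2 := by
  rw [← not_lt, two_lt_card]
  rintro ⟨x, hx, y, hy, z, hz, hxy, hxz, hyz⟩
  rw [mem_filter_univ] at hx hy hz
  -- Two distinct roots of m x² + b x = 1 determine each other through their sum.
  have key : ∀ u v : F, u ≠ 0 ∧ u⁻¹ = m * u + b → v ≠ 0 ∧ v⁻¹ = m * v + b → u ≠ v →
      m * (u + v) + b = 0 := by
    rintro u v ⟨hu0, hu⟩ ⟨hv0, hv⟩ huv
    have h1 : 1 = (m * u + b) * u := by rw [← hu, inv_mul_cancel₀ hu0]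
    have h2 : 1 = (m * v + b) * v := by rw [← hv, inv_mul_cancel₀ hv0]
    refine mul_left_cancel₀ (sub_ne_zero.2 huv) ?_
    linear_combination h2 - h1
  have h1 := key x y hx hy hxy
  have h2 := key x z hx hz hxz
  exact hyz (mul_left_cancel₀ hm (by linear_combination h1 - h2))

/-- An oblique line meets the hyperbola x y = 1 at most twice, so a triple must use the origin and
lie on some y = m x. -/
theorem two_mul_numCollinearTriples_invPerm_le :
    2 * numCollinearTriples (invPerm F) ≤ Fintype.card F - 1 := by
  rw [numCollinearTriples_eq_sum, obliqueLines_eq_product, sum_product, mul_sum]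
  have hcount : ∀ m b : F, lineCount (invPerm F) (m, b) =
      (if b = 0 then 1 else 0) + #{x | x ≠ 0 ∧ x⁻¹ = m * x + b} := by
    intro m b
    have := card_filter_add_card_filter_not (s := ({x | x⁻¹ = m * x + b} : Finset F))
      (fun x => x = 0)
    change #{x | x⁻¹ = m * x + b} = _
    rw [← this, filter_filter, filter_filter]
    congr 1
    · split_ifs with hb
      · rw [card_eq_one]
        refine ⟨0, ?_⟩
        ext x
        simp only [mem_filter, mem_univ, true_and, mem_singleton, and_iff_right_iff_imp]
        rintro rfl
        simp [hb]
      · rw [card_eq_zero, filter_eq_empty_iff]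
        rintro x - ⟨h1, rfl⟩
        simp at h1
        exact hb h1.symm
    · congr 1
      ext x
      simp [and_comm]
  have hslope : ∀ m ∈ univ.erase (0 : F),
      2 * ∑ b, (lineCount (invPerm F) (m, b)).choose 3 ≤ #{x | x ≠ 0 ∧ x⁻¹ = m * x + 0} := by
    intro m hm
    have hm0 : m ≠ 0 := by simpa using hm
    rw [Fintype.sum_eq_single 0]
    · have h2 := card_filter_quadratic_le_two hm0 0
      rw [hcount, if_pos rfl]
      interval_cases #{x | x ≠ 0 ∧ x⁻¹ = m * x + 0} <;> simp [Nat.choose]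
    · intro b hb
      rw [hcount, if_neg hb, zero_add]
      exact Nat.choose_eq_zero_of_lt (by have := card_filter_quadratic_le_two hm0 b; omega)
  refine (sum_le_sum hslope).trans (le_of_eq ?_)
  -- Each nonzero x satisfies x⁻¹ = m x for the single slope m = x⁻².
  rw [← card_univ, ← card_erase_of_mem (mem_univ (0 : F)),
    card_eq_sum_card_fiberwise (f := fun x => x⁻¹ * x⁻¹) (t := univ.erase 0)
    (fun x hx => by simpa using hx)]
  refine sum_congr rfl fun m _ => ?_
  congr 1
  ext x
  simp only [mem_filter, mem_univ, true_and, mem_erase, and_true, add_zero]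
  refine and_congr_right fun hx => ?_
  rw [← eq_mul_inv_iff_mul_eq₀ (inv_ne_zero hx), inv_inv]

theorem isMinimizing_iff_two_mul (hq : Odd (Fintype.card F)) (σ : Equiv.Perm F) :
    IsMinimizing σ ↔ 2 * numCollinearTriples σ = Fintype.card F - 1 := by
  constructor
  · intro h
    have h1 := h (invPerm F)
    have h2 := two_mul_numCollinearTriples_invPerm_le (F := F)
    have h3 := card_sub_one_le_two_mul_numCollinearTriples hq σ
    omega
  · intro h τ
    have := card_sub_one_le_two_mul_numCollinearTriples hq τ
    omega

/-- The excess is squeezed between its lower bound and the number of triples, which agree for a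
minimizer. -/
theorem two_mul_sum_choose_two_of_isMinimizing (hq : Odd (Fintype.card F)) {σ : Equiv.Perm F}
    (h : IsMinimizing σ) :
    2 * ∑ l ∈ obliqueLines F, (lineCount σ l - 1).choose 2 = Fintype.card F - 1 := by
  rw [isMinimizing_iff_two_mul hq, numCollinearTriples_eq_sum] at h
  have h1 := card_sub_one_le_two_mul_sum_choose_two hq σ
  have h2 := sum_le_sum fun l (_ : l ∈ obliqueLines F) =>
    choose_pred_two_le_choose_three (lineCount σ l)
  omega

/-- The number of oblique lines that meet the graph. -/
theorem two_mul_card_filter_lineCount_ne_zero (σ : Equiv.Perm F) :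
    2 * #{l ∈ obliqueLines F | lineCount σ l ≠ 0} = (Fintype.card F - 1) * Fintype.card F +
      2 * ∑ l ∈ obliqueLines F, (lineCount σ l - 1).choose 2 := by
  have hpoint : ∀ n : ℕ, 2 * (if n ≠ 0 then 1 else 0) + n * (n - 1) =
      2 * n + 2 * (n - 1).choose 2 := by
    rintro (_ | n)
    · simp
    · simp only [Nat.add_sub_cancel, Nat.choose_two_right,
        Nat.mul_div_cancel' (Nat.even_mul_pred_self _).two_dvd]
      rcases n with _ | n
      · simp
      · simp only [Nat.add_sub_cancel, ne_eq, Nat.succ_ne_zero, not_false_eq_true, if_true]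
        ring
  have h := sum_congr rfl fun l (_ : l ∈ obliqueLines F) => hpoint (lineCount σ l)
  rw [sum_add_distrib, sum_add_distrib, sum_lineCount_mul_sub_one, ← mul_sum, ← mul_sum, ← mul_sum,
    sum_lineCount, ← card_filter] at h
  omega

end Counting

/-! ### Lines of the projective plane meeting Ω -/

section Projective

variable {F : Type*} [Field F]

/-- The line of the projective plane with the equation `a 0 * X + a 1 * Y + a 2 * Z = 0`. -/
def projLine (a : Fin 3 → F) : Set (ProjPlane F) :=
  {P | a ⬝ᵥ P.rep = 0}

theorem mk_mem_projLine (a v : Fin 3 → F) (hv : v ≠ 0) :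
    (Projectivization.mk F v hv : ProjPlane F) ∈ projLine a ↔ a ⬝ᵥ v = 0 := by
  obtain ⟨c, hc⟩ := Projectivization.exists_smul_eq_mk_rep F v hv
  rw [projLine, Set.mem_ofPred_eq, ← hc, Units.smul_def, dotProduct_smul, smul_eq_mul,
    mul_eq_zero]
  simp

theorem projLine_smul {c : F} (hc : c ≠ 0) (a : Fin 3 → F) : projLine (c • a) = projLine a := by
  ext P
  simp [projLine, hc]

theorem isLine_iff_exists_projLine (l : Set (ProjPlane F)) :
    IsLine l ↔ ∃ a : Fin 3 → F, a ≠ 0 ∧ l = projLine a := by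
  have hker : ∀ f : (Fin 3 → F) →ₗ[F] F, ∀ v, f v = (fun i => f (Pi.single i 1)) ⬝ᵥ v := by
    intro f v
    rw [LinearMap.pi_apply_eq_sum_univ f v, dotProduct]
    refine sum_congr rfl fun i _ => ?_
    rw [smul_eq_mul, mul_comm]
    congr 2
    ext j
    simp [Pi.single_apply, eq_comm]
  have hpoint : ∀ (f : (Fin 3 → F) →ₗ[F] F) (P : ProjPlane F),
      P.submodule ≤ LinearMap.ker f ↔ f P.rep = 0 := by
    intro f P
    rw [Projectivization.submodule_eq, Submodule.span_singleton_le_iff_mem, LinearMap.mem_ker]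
  have hdim : ∀ f : (Fin 3 → F) →ₗ[F] F, f ≠ 0 → Module.finrank F (LinearMap.ker f) = 2 := by
    intro f hf
    have := Module.Dual.finrank_ker_add_one_of_ne_zero (f := f) hf
    rw [Module.finrank_fin_fun] at this
    omega
  constructor
  · rintro ⟨W, hW, rfl⟩
    have hlt : W < ⊤ := lt_top_iff_ne_top.2 fun h => by
      rw [h, finrank_top, Module.finrank_fin_fun] at hW
      omega
    obtain ⟨f, hf, hWf⟩ := Submodule.exists_le_ker_of_lt_top W hlt
    have hWeq := Submodule.eq_of_le_of_finrank_eq hWf (hW.trans (hdim f hf).symm)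
    refine ⟨fun i => f (Pi.single i 1), fun h0 => hf ?_, ?_⟩
    · refine LinearMap.ext fun v => ?_
      rw [hker, h0, zero_dotProduct, LinearMap.zero_apply]
    · ext P
      rw [hWeq, Set.mem_ofPred_eq, hpoint, hker, projLine, Set.mem_ofPred_eq]
  · rintro ⟨a, ha, rfl⟩
    let f : (Fin 3 → F) →ₗ[F] F := dotProductBilin F F a
    have hfa : ∀ v, f v = a ⬝ᵥ v := fun v => rfl
    have hf : f ≠ 0 := fun h => ha <| by
      ext i
      have := hfa (Pi.single i 1)
      simpa [h] using this.symm
    refine ⟨LinearMap.ker f, hdim f hf, ?_⟩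
    ext P
    rw [Set.mem_ofPred_eq, hpoint, hfa, projLine, Set.mem_ofPred_eq]

/-- Normalized coefficients of the lines of the projective plane: `inl (m, b)` stands for
`y = m * x + b`, `inr (some c)` for `x = c`, and `inr none` for the line at infinity. -/
def lineCoeffs : (F × F) ⊕ Option F → Fin 3 → F
  | .inl l => ![l.1, -1, l.2]
  | .inr (some c) => ![1, 0, -c]
  | .inr none => ![0, 0, 1]

theorem lineCoeffs_ne_zero (i : (F × F) ⊕ Option F) : lineCoeffs i ≠ 0 := by
  intro h
  rcases i with l | _ | c
  · simpa [lineCoeffs] using congrFun h 1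
  · simpa [lineCoeffs] using congrFun h 2
  · simpa [lineCoeffs] using congrFun h 0

theorem isLine_iff_mem_range (l : Set (ProjPlane F)) :
    IsLine l ↔ l ∈ Set.range fun i => projLine (lineCoeffs (F := F) i) := by
  rw [isLine_iff_exists_projLine]
  constructor
  · rintro ⟨a, ha, rfl⟩
    suffices h : ∃ (i : (F × F) ⊕ Option F) (c : F), c ≠ 0 ∧ c • lineCoeffs i = a by
      obtain ⟨i, c, hc, rfl⟩ := h
      exact ⟨i, (projLine_smul hc _).symm⟩
    by_cases h1 : a 1 = 0
    · by_cases h0 : a 0 = 0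
      · have h2 : a 2 ≠ 0 := fun h2 => ha (by ext i; fin_cases i <;> assumption)
        refine ⟨.inr none, a 2, h2, ?_⟩
        ext i
        fin_cases i <;> simp [lineCoeffs, h0, h1]
      · refine ⟨.inr (some (-(a 2 / a 0))), a 0, h0, ?_⟩
        ext i
        fin_cases i <;> simp [lineCoeffs, h1, mul_div_cancel₀, h0]
    · refine ⟨.inl (-(a 0 / a 1), -(a 2 / a 1)), -a 1, neg_ne_zero.2 h1, ?_⟩
      ext i
      fin_cases i <;> simp [lineCoeffs, mul_div_cancel₀, h1]
  · rintro ⟨i, rfl⟩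
    exact ⟨_, lineCoeffs_ne_zero i, rfl⟩

theorem slope_ne_zero (m : F) : (![1, m, 0] : Fin 3 → F) ≠ 0 :=
  fun h => one_ne_zero (congrFun h 0)

theorem projLine_lineCoeffs_injective :
    Function.Injective fun i => projLine (lineCoeffs (F := F) i) := by
  have hinl : ∀ (l : F × F) (i : (F × F) ⊕ Option F),
      projLine (lineCoeffs (.inl l)) = projLine (lineCoeffs i) → .inl l = i := by
    rintro ⟨m, b⟩ i h
    -- The line y = m x + b is recovered from its points [0 : b : 1] and [1 : m : 0].
    have h1 : (Projectivization.mk F ![0, b, 1] (affine_ne_zero 0 b) : ProjPlane F) ∈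
        projLine (lineCoeffs i) := by
      rw [← h, mk_mem_projLine]
      simp [lineCoeffs, dotProduct, Fin.sum_univ_three]
    have h2 : (Projectivization.mk F ![1, m, 0] (slope_ne_zero m) : ProjPlane F) ∈
        projLine (lineCoeffs i) := by
      rw [← h, mk_mem_projLine]
      simp [lineCoeffs, dotProduct, Fin.sum_univ_three]
    rw [mk_mem_projLine] at h1 h2
    rcases i with ⟨m', b'⟩ | _ | c
    · simp only [lineCoeffs, dotProduct, Fin.sum_univ_three, Matrix.cons_val] at h1 h2
      congr 2
      · linear_combination -h2
      · linear_combination -h1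
    · simp [lineCoeffs, dotProduct, Fin.sum_univ_three] at h1
    · simp [lineCoeffs, dotProduct, Fin.sum_univ_three] at h2
  have hvert : ∀ (c : F) (j : Option F),
      projLine (lineCoeffs (.inr (some c))) = projLine (lineCoeffs (.inr j)) → some c = j := by
    intro c j h
    have h1 : (Projectivization.mk F ![c, 0, 1] (affine_ne_zero c 0) : ProjPlane F) ∈
        projLine (lineCoeffs (.inr j)) := by
      rw [← h, mk_mem_projLine]
      simp [lineCoeffs, dotProduct, Fin.sum_univ_three]
    rw [mk_mem_projLine] at h1
    rcases j with _ | c'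
    · simp [lineCoeffs, dotProduct, Fin.sum_univ_three] at h1
    · simp only [lineCoeffs, dotProduct, Fin.sum_univ_three, Matrix.cons_val] at h1
      congr 1
      linear_combination h1
  rintro (l | _ | c) (l' | _ | c') h
  · exact hinl _ _ h
  · exact hinl _ _ h
  · exact hinl _ _ h
  · exact (hinl _ _ h.symm).symm
  · rfl
  · exact congrArg _ (hvert _ _ h.symm).symm
  · exact (hinl _ _ h.symm).symm
  · exact congrArg _ (hvert _ _ h)
  · exact congrArg _ (hvert _ _ h)

theorem projLine_inr_inter_Omega_nonempty (σ : Equiv.Perm F) (i : Option F) :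
    (projLine (lineCoeffs (.inr i)) ∩ Omega σ).Nonempty := by
  refine ⟨Projectivization.mk F ![0, 1, 0] e₁_ne_zero, ?_, Or.inr (Or.inr rfl)⟩
  rw [mk_mem_projLine]
  rcases i with _ | c <;> simp [lineCoeffs, dotProduct, Fin.sum_univ_three]

variable [Fintype F] [DecidableEq F]

theorem projLine_inl_inter_Omega_nonempty (σ : Equiv.Perm F) (l : F × F) :
    (projLine (lineCoeffs (.inl l)) ∩ Omega σ).Nonempty ↔ l.1 = 0 ∨ lineCount σ l ≠ 0 := by
  have hcount : lineCount σ l ≠ 0 ↔ ∃ x, σ x = l.1 * x + l.2 := by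
    rw [lineCount, card_ne_zero]
    simp [Finset.Nonempty]
  rw [hcount]
  constructor
  · rintro ⟨P, hP, ⟨⟨x, y⟩, hxy, rfl⟩ | rfl | rfl⟩
    · have hy : y = σ x := hxy
      rw [rho, mk_mem_projLine] at hP
      simp only [lineCoeffs, dotProduct, Fin.sum_univ_three, Matrix.cons_val] at hP
      exact Or.inr ⟨x, by rw [← hy]; linear_combination -hP⟩
    · rw [mk_mem_projLine] at hP
      simp [lineCoeffs, dotProduct, Fin.sum_univ_three] at hP
      exact Or.inl hP
    · rw [mk_mem_projLine] at hP
      simp [lineCoeffs, dotProduct, Fin.sum_univ_three] at hP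
  · rintro (h | ⟨x, hx⟩)
    · refine ⟨Projectivization.mk F ![1, 0, 0] e₀_ne_zero, ?_, Or.inr (Or.inl rfl)⟩
      rw [mk_mem_projLine]
      simp [lineCoeffs, dotProduct, Fin.sum_univ_three, h]
    · refine ⟨rho (x, σ x), ?_, Or.inl ⟨(x, σ x), rfl, rfl⟩⟩
      rw [rho, mk_mem_projLine]
      simp only [lineCoeffs, dotProduct, Fin.sum_univ_three, Matrix.cons_val]
      rw [hx]
      ring

/-- The term 2q+1 counts the q horizontal lines, through [1 : 0 : 0], and the q vertical lines and
the line at infinity, through [0 : 1 : 0]. -/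
theorem numLinesMeeting_Omega (σ : Equiv.Perm F) :
    numLinesMeeting (Omega σ) =
      2 * Fintype.card F + 1 + #{l ∈ obliqueLines F | lineCount σ l ≠ 0} := by
  have hset : {l : Set (ProjPlane F) | IsLine l ∧ (l ∩ Omega σ).Nonempty} =
      (fun i => projLine (lineCoeffs (F := F) i)) ''
        ↑(({l | l.1 = 0 ∨ lineCount σ l ≠ 0} : Finset (F × F)).disjSum
          (univ : Finset (Option F))) := by
    ext l
    rw [Set.mem_ofPred_eq, isLine_iff_mem_range]
    constructor
    · rintro ⟨⟨i, rfl⟩, h⟩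
      refine ⟨i, ?_, rfl⟩
      rcases i with p | j
      · simpa using (projLine_inl_inter_Omega_nonempty σ p).1 h
      · simp
    · rintro ⟨i, hi, rfl⟩
      refine ⟨⟨i, rfl⟩, ?_⟩
      rcases i with p | j
      · exact (projLine_inl_inter_Omega_nonempty σ p).2 (by simpa using hi)
      · exact projLine_inr_inter_Omega_nonempty σ j
  have hsplit : ({l | l.1 = 0 ∨ lineCount σ l ≠ 0} : Finset (F × F)) =
      ({0} ×ˢ univ) ∪ {l ∈ obliqueLines F | lineCount σ l ≠ 0} := by
    ext l
    simp only [mem_filter, mem_univ, true_and, mem_union, mem_product, mem_singleton, and_true,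
      mem_obliqueLines]
    tauto
  have hdisj : Disjoint (({0} : Finset F) ×ˢ (univ : Finset F))
      {l ∈ obliqueLines F | lineCount σ l ≠ 0} := by
    rw [disjoint_left]
    intro l h1 h2
    rw [mem_filter, mem_obliqueLines] at h2
    exact h2.1 (mem_singleton.1 (mem_product.1 h1).1)
  rw [numLinesMeeting, hset, Set.ncard_image_of_injective _ projLine_lineCoeffs_injective,
    Set.ncard_coe_finset, card_disjSum, hsplit, card_union_of_disjoint hdisj, card_product,
    card_singleton, card_univ, card_univ, Fintype.card_option]
  ring

end Projective

end CollinearTriples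

theorem proposition2p2 {F : Type*} [Field F] [Fintype F] (hq : Odd (Fintype.card F))
    (σ : Equiv.Perm F) :
    (CollinearTriples.IsMinimizing σ ↔
      (CollinearTriples.numCollinearTriples σ : ℚ) = ((Fintype.card F : ℚ) - 1) / 2) ∧
    (CollinearTriples.IsMinimizing σ →
      (CollinearTriples.numLinesMeeting (CollinearTriples.Omega σ) : ℚ) =
        ((Fintype.card F : ℚ) + 1) * ((Fintype.card F : ℚ) + 2) / 2
          + ((Fintype.card F : ℚ) - 1) / 2) := by
  classical
  have hcast : ((Fintype.card F - 1 : ℕ) : ℚ) = (Fintype.card F : ℚ) - 1 :=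
    Nat.cast_pred Fintype.card_pos
  constructor
  · rw [CollinearTriples.isMinimizing_iff_two_mul hq, eq_div_iff two_ne_zero, ← hcast,
      mul_comm 2]
    norm_cast
  · intro h
    have h1 := CollinearTriples.two_mul_card_filter_lineCount_ne_zero σ
    rw [CollinearTriples.two_mul_sum_choose_two_of_isMinimizing hq h] at h1
    have h2 := congrArg (Nat.cast (R := ℚ)) h1
    push_cast [hcast] at h2
    rw [CollinearTriples.numLinesMeeting_Omega]
    push_cast
    linear_combination h2 / 2
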